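/- Fix a finite alphabet $\Sigma$ and a finite set $\mathcal I$ of closed intervals with natural-number endpoints (the upper endpoint may be $\infty$) with $[0,0]\in\mathcal I$; write $\Sigma_\varepsilon=\Sigma\cup\{\varepsilon\}$. **Words with timing constraints.** A TCW is $\mathcal V=(V,\to,(\curvearrowright^I)_{I\in\mathcal I},\lambda)$, where $V$ is a finite totally ordered set, $\to$ is its immediate-successor relation, ${\curvearrowright^I}\subseteq{<}$ and $\lambda\colon V\to\Sigma_\varepsilon$. Put ${\curvearrowright}=\bigcup_I{\curvearrowright^I}$. $\mathcal V$ is simple (an STCW) if for each $v\in V$ the number of $u$ with $u\curvearrowright v$ plus the number of $w$ with $v\curvearrowright w$ is at most $1$. **Split-width.** A split-TCW is a TCW whose successor pairs are divided into present edges $\to$ and holes $\dashrightarrow$; its width is $1+|{\dashrightarrow}|$. It is atomic if it has a single point, or exactly two points $p,q$ with $p\dashrightarrow q$ and exactly one timing constraint $p\curvearrowright^I q$. Connectedness refers to ${\to}\cup{\curvearrowright}$. A split-tree for $\mathcal V$ is a finite tree labelled by split-TCWs with root label $\mathcal V$ such that leaves have atomic labels; a unary node has a connected label, and its child's label is obtained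 by turning one present edge into a hole; a binary node has a disconnected label $\mathcal V_1\uplus\mathcal V_2$ with $\mathcal V_1,\mathcal V_2$ non-empty and no present edge or constraint between them, and its children are labelled $\mathcal V_1$ and $\mathcal V_2$ (with the induced orders, where successor pairs that are not present edges are holes). The width of the tree is the maximal width of a label. The split-width of $\mathcal V$ is the least width of a split-tree for $\mathcal V$ ($\infty$ if there is none). TCWs are regarded as split-TCWs without holes. **Timed systems.** A timed pushdown automaton (TPDA) $\mathcal S=(S,s_0,\Sigma,\Gamma,\Delta,X,F)$ has a finite set $S$ of states, $s_0\in S$, $F\subseteq S$, a finite stack alphabet $\Gamma$, a finite set $X$ of clocks, and a finite set $\Delta$ of transitions $(s,\gamma,a,\mathsf{op},R,s')$, where $\gamma$ is a finite conjunction of atoms $x\in I$ ($x\in X$, $I\in\mathcal I$), $a\in\Sigma$, $R\subseteq X$, and $\mathsf{op}$ is $\mathsf{nop}$, a push $\downarrow_c$ or a pop $\uparrow_c^I$ ($c\in\Gamma$, $I\in\mathcal I$). It is a timed automaton if every transition uses $\mathsf{nop}$. **Generated words.** An STCW $\mathcal V$ is generated by $\mathcal S$ if there are a run of transitions $\delta_i=(s_{i-1},\gamma_i,a_i,\mathsf{op}_i,R_i,s_i)\in\Delta$,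 $1\le i\le n$, $n\ge 0$, with $s_n\in F$, such that the following holds, where $R_0=X$, $h_0=0$, and $h_i$ is the number of conjuncts of $\gamma_i$. * The sequence $\mathsf{op}_1\cdots\mathsf{op}_n$ is well-nested: no prefix has more pops than pushes, and in total they are equally many. The pop matching a push $\mathsf{op}_i$ is the $\mathsf{op}_j$ with $i<j$ such that $\mathsf{op}_{i+1}\cdots\mathsf{op}_{j-1}$ is well-nested. Matching pushes and pops have the same stack symbol. * $V$ consists, in this order, of $V_0,\dots,V_n$, where for some $g_0,\dots,g_n\ge0$ the points of $V_i$ are, in order, $\ell_i,\ell_i^1,\dots,\ell_i^{h_i},p_i,r_i^1,\dots,r_i^{g_i},r_i$ (with no $p_0$ in $V_0$). Moreover $\lambda(p_i)=a_i$, and all other points are labelled $\varepsilon$. * ${\curvearrowright^I}$ is the union of the following relations: if $I=[0,0]$, all pairs $(\ell_i,r_i)$, $0\le i\le n$; all pairs $(p_i,p_j)$ such that $\mathsf{op}_i=\downarrow_b$ is a push and $\mathsf{op}_j=\uparrow_b^I$ is its matching pop; and relations $\curvearrowright^{x\in I}$ for $x\in X$. * Call $(i,j,t)$ an $(x,I)$-triple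 if $0\le i<j\le n$, the $t$-th conjunct of $\gamma_j$ is $x\in I$, $x\in R_i$, and $x\notin R_k$ for $i<k<j$. For each $(x,I)$-triple $(i,j,t)$ there is $s$ with $r_i^s\curvearrowright^{x\in I}\ell_j^t$, and all pairs in $\curvearrowright^{x\in I}$ are of this form. Write ${\curvearrowright^x}=\bigcup_I{\curvearrowright^{x\in I}}$. * Each $r_i^s$ is in $\mathrm{dom}({\curvearrowright^x})$ for some $x\in R_i$. If $s<u<t$ and $r_i^s,r_i^t\in\mathrm{dom}({\curvearrowright^x})$, then $r_i^u\in\mathrm{dom}({\curvearrowright^x})$. If $r_i^s\curvearrowright^x v$, $r_i^{s'}\curvearrowright^x v'$ and $s<s'$, then $r_i^{s'}<v'<v$. **Theorem.** Let $\mathcal S$ be a TPDA with set of clocks $X$. Every STCW generated by $\mathcal S$ has split-width at most $4|X|+6$. If $\mathcal S$ is a timed automaton, every STCW generated by $\mathcal S$ has split-width at most $|X|+4$. -/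

import Mathlib

/-- A closed interval with integer endpoints; the upper endpoint may also be infinite. -/
structure TimeInterval where
  lo : ℕ
  up : ℕ∞
  lo_le_up : (lo : ℕ∞) ≤ up

/-- The interval `[0,0]`. -/
def TimeInterval.zero : TimeInterval := ⟨0, 0, le_rfl⟩

/-- A finite set of intervals containing `[0,0]`. (A bound on the finite endpoints exists
automatically, since the set is finite.) -/
structure IntervalFamily where
  intervals : Finset TimeInterval
  zero_mem : TimeInterval.zero ∈ intervals

/-- The members of an interval family. -/
abbrev IntervalFamily.Elem (ℐ : IntervalFamily) : Type := {I : TimeInterval // I ∈ ℐ.intervals}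

/-- The interval `[0,0]` as a member of the family. -/
def IntervalFamily.zero (ℐ : IntervalFamily) : ℐ.Elem := ⟨TimeInterval.zero, ℐ.zero_mem⟩

/-! ### Words with timing constraints -/

/-- A word with timing constraints on the finite, linearly ordered set of positions `V`.
The successor relation `→` is the covering relation `⋖` of the order; on a finite set, giving
the order `→*` and giving `→` amount to the same. Labels are letters of `A` or `none`, the
silent action. -/
structure TCW (A : Type*) (ℐ : IntervalFamily) (V : Type*) [LinearOrder V] where
  constr : ℐ.Elem → V → V → Prop
  constr_lt : ∀ I u v, constr I u v → u < v
  label : V → Option A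

namespace TCW

variable {A : Type*} {ℐ : IntervalFamily} {V : Type*} [LinearOrder V]

/-- Number of positions `u` with a timing constraint from `u` to `v`. -/
noncomputable def indegree (W : TCW A ℐ V) (v : V) : ℕ :=
  Set.ncard {u | ∃ I, W.constr I u v}

/-- Number of positions `w` with a timing constraint from `v` to `w`. -/
noncomputable def outdegree (W : TCW A ℐ V) (v : V) : ℕ :=
  Set.ncard {w | ∃ I, W.constr I v w}

/-- Every position carries at most one timing constraint, incoming or outgoing. -/
def IsSimple (W : TCW A ℐ V) : Prop := ∀ v, W.indegree v + W.outdegree v ≤ 1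

end TCW

/-! ### Split words, the split-game and split-width -/

/-- `v` is the immediate successor of `u` in the set `s` of positions. -/
def IsSuccIn {V : Type*} [LinearOrder V] (s : Finset V) (u v : V) : Prop :=
  u ∈ s ∧ v ∈ s ∧ u < v ∧ ∀ w ∈ s, ¬ (u < w ∧ w < v)

/-- A split-TCW whose set of positions is the finite subset `verts` of a linear order `V`.
`arc` consists of the present successor edges; the other successor pairs are the holes. -/
structure SplitTCW (A : Type*) (ℐ : IntervalFamily) (V : Type*) [LinearOrder V] where
  verts : Finset V
  arc : V → V → Prop
  arc_succ : ∀ u v, arc u v → IsSuccIn verts u v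
  constr : ℐ.Elem → V → V → Prop
  constr_lt : ∀ I u v, constr I u v → u ∈ verts ∧ v ∈ verts ∧ u < v
  label : V → Option A

namespace SplitTCW

variable {A : Type*} {ℐ : IntervalFamily} {V : Type*} [LinearOrder V]

/-- The absent successor edges. -/
def hole (W : SplitTCW A ℐ V) (u v : V) : Prop := IsSuccIn W.verts u v ∧ ¬ W.arc u v

/-- The number of blocks: one more than the number of holes. -/
noncomputable def width (W : SplitTCW A ℐ V) : ℕ :=
  1 + Set.ncard {p : V × V | W.hole p.1 p.2}

/-- There is a present successor edge or a timing constraint from `u` to `v`. -/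
def edge (W : SplitTCW A ℐ V) (u v : V) : Prop := W.arc u v ∨ ∃ I, W.constr I u v

/-- Connectedness with respect to present successor edges and timing constraints. -/
def Connected (W : SplitTCW A ℐ V) : Prop :=
  W.verts.Nonempty ∧ ∀ u ∈ W.verts, ∀ v ∈ W.verts, Relation.EqvGen W.edge u v

/-- A single point, or a single timing constraint whose two points are separated by a hole. -/
def IsAtomic (W : SplitTCW A ℐ V) : Prop :=
  (∃ p, W.verts = {p}) ∨
    ∃ p q I, W.verts = {p, q} ∧ W.hole p q ∧
      ∀ J u v, W.constr J u v ↔ J = I ∧ u = p ∧ v = q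

/-- Eve's move: the successor edge from `a` to `b` is removed (it becomes a hole). -/
def cut (W : SplitTCW A ℐ V) (a b : V) : SplitTCW A ℐ V where
  verts := W.verts
  arc u v := W.arc u v ∧ ¬ (u = a ∧ v = b)
  arc_succ u v h := W.arc_succ u v h.1
  constr := W.constr
  constr_lt := W.constr_lt
  label := W.label

/-- The split-TCW induced on the positions in `s`: the order is inherited, and so are the edges
between positions of `s`. -/
def restrict (W : SplitTCW A ℐ V) (s : Finset V) : SplitTCW A ℐ V where
  verts := W.verts ∩ s
  arc u v := W.arc u v ∧ u ∈ s ∧ v ∈ s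
  arc_succ u v h := by
    obtain ⟨h1, h2, h3, h4⟩ := W.arc_succ u v h.1
    exact ⟨Finset.mem_inter.2 ⟨h1, h.2.1⟩, Finset.mem_inter.2 ⟨h2, h.2.2⟩, h3,
      fun w hw => h4 w (Finset.mem_inter.1 hw).1⟩
  constr I u v := W.constr I u v ∧ u ∈ s ∧ v ∈ s
  constr_lt I u v h := by
    obtain ⟨h1, h2, h3⟩ := W.constr_lt I u v h.1
    exact ⟨Finset.mem_inter.2 ⟨h1, h.2.1⟩, Finset.mem_inter.2 ⟨h2, h.2.2⟩, h3⟩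
  label := W.label

/-- The positions are partitioned into two non-empty sets `s`, `t` with no present successor edge
and no timing constraint between them: `W` is disconnected, the disjoint union of its
restrictions to `s` and `t`. -/
def Separates (W : SplitTCW A ℐ V) (s t : Finset V) : Prop :=
  s.Nonempty ∧ t.Nonempty ∧ Disjoint s t ∧ s ∪ t = W.verts ∧
    ∀ u ∈ s, ∀ v ∈ t, ¬ W.edge u v ∧ ¬ W.edge v u

/-- Split-trees with a given root label: leaves are atomic, a unary node is a connected
split-TCW from which Eve removes one successor edge, a binary node is a disconnected split-TCW
that is decomposed as a disjoint union. -/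
inductive SplitTree : SplitTCW A ℐ V → Type _
  | leaf (W : SplitTCW A ℐ V) (h : W.IsAtomic) : SplitTree W
  | unary (W : SplitTCW A ℐ V) (hW : W.Connected) (a b : V) (hab : W.arc a b)
      (child : SplitTree (W.cut a b)) : SplitTree W
  | binary (W : SplitTCW A ℐ V) (s t : Finset V) (h : W.Separates s t)
      (left : SplitTree (W.restrict s)) (right : SplitTree (W.restrict t)) : SplitTree W

/-- The largest width of a label of the split-tree. -/
noncomputable def SplitTree.width : {W : SplitTCW A ℐ V} → SplitTree W → ℕ
  | W, .leaf _ _ => SplitTCW.width W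
  | W, .unary _ _ _ _ _ child => max (SplitTCW.width W) child.width
  | W, .binary _ _ _ _ left right => max (SplitTCW.width W) (max left.width right.width)

/-- The least width of a split-tree with root `W` (`⊤` if there is none). -/
noncomputable def splitWidth (W : SplitTCW A ℐ V) : ℕ∞ := ⨅ T : SplitTree W, (T.width : ℕ∞)

end SplitTCW

/-- A TCW is a split-TCW without holes. -/
def TCW.toSplit {A : Type*} {ℐ : IntervalFamily} {V : Type*} [LinearOrder V] [Fintype V]
    (W : TCW A ℐ V) : SplitTCW A ℐ V where
  verts := Finset.univ
  arc u v := u ⋖ v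
  arc_succ u v h := ⟨Finset.mem_univ u, Finset.mem_univ v, h.lt, fun _ _ hw => h.2 hw.1 hw.2⟩
  constr := W.constr
  constr_lt I u v h := ⟨Finset.mem_univ u, Finset.mem_univ v, W.constr_lt I u v h⟩
  label := W.label

/-- The simple TCWs on `V` of split-width at most `K`. -/
def boundedSTCW (A : Type*) (ℐ : IntervalFamily) (V : Type*) [LinearOrder V] [Fintype V]
    (K : ℕ) : Set (TCW A ℐ V) :=
  {W | W.IsSimple ∧ W.toSplit.splitWidth ≤ (K : ℕ∞)}

/-! ### Timed pushdown automata -/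

/-- Stack operations: `nop`, push `c`, and pop `c` with age in `I`. -/
inductive StackOp (Γ : Type*) (ℐ : IntervalFamily) where
  | nop : StackOp Γ ℐ
  | push (c : Γ) : StackOp Γ ℐ
  | pop (c : Γ) (I : ℐ.Elem) : StackOp Γ ℐ

def StackOp.isPush {Γ : Type*} {ℐ : IntervalFamily} : StackOp Γ ℐ → Bool
  | .push _ => true
  | _ => false

def StackOp.isPop {Γ : Type*} {ℐ : IntervalFamily} : StackOp Γ ℐ → Bool
  | .pop _ _ => true
  | _ => false

/-- A transition; the guard is the finite conjunction of the atoms `x ∈ I` in the list. -/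
structure Transition (Q A Γ X : Type*) (ℐ : IntervalFamily) where
  src : Q
  guard : List (X × ℐ.Elem)
  letter : A
  op : StackOp Γ ℐ
  resets : Set X
  tgt : Q

/-- A timed pushdown automaton with states `Q`, input alphabet `A`, stack alphabet `Γ` and
clocks `X`. -/
structure TPDA (Q A Γ X : Type*) (ℐ : IntervalFamily) where
  init : Q
  trans : Set (Transition Q A Γ X ℐ)
  trans_finite : trans.Finite
  final : Set Q

/-- A timed automaton is a TPDA that uses `nop` operations only. -/
def TPDA.IsTimedAutomaton {Q A Γ X : Type*} {ℐ : IntervalFamily} (S : TPDA Q A Γ X ℐ) : Prop :=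
  ∀ d ∈ S.trans, d.op = StackOp.nop

/-! ### The simple TCWs generated by a TPDA

A run is a sequence `δ 0, …, δ (n-1)` of transitions. Block `0` of positions encodes the initial
reset of all clocks, and block `k + 1` encodes the transition `δ k`. -/

section Run

variable {Q A Γ X : Type*} {ℐ : IntervalFamily} {n : ℕ}

/-- The guard checked in a block (none in block `0`). -/
def blockGuard (δ : Fin n → Transition Q A Γ X ℐ) : Fin (n + 1) → List (X × ℐ.Elem) :=
  Fin.cases [] (fun k => (δ k).guard)

/-- The clocks reset in a block (all clocks in block `0`). -/
def blockResets (δ : Fin n → Transition Q A Γ X ℐ) : Fin (n + 1) → Set X :=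
  Fin.cases Set.univ (fun k => (δ k).resets)

/-- The number of pushes among the operations `δ k` with `a ≤ k < b`. -/
def pushes (δ : Fin n → Transition Q A Γ X ℐ) (a b : ℕ) : ℕ :=
  (Finset.univ.filter fun k : Fin n => a ≤ k.val ∧ k.val < b ∧ (δ k).op.isPush = true).card

/-- The number of pops among the operations `δ k` with `a ≤ k < b`. -/
def pops (δ : Fin n → Transition Q A Γ X ℐ) (a b : ℕ) : ℕ :=
  (Finset.univ.filter fun k : Fin n => a ≤ k.val ∧ k.val < b ∧ (δ k).op.isPop = true).card

/-- The operations `δ k` with `a ≤ k < b` are well-nested: no prefix has more pops than pushes,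
and the whole sequence has equally many. -/
def WellNested (δ : Fin n → Transition Q A Γ X ℐ) (a b : ℕ) : Prop :=
  (∀ m, m ≤ b → pops δ a m ≤ pushes δ a m) ∧ pops δ a b = pushes δ a b

/-- `δ i` is a push and `δ j` is the matching pop: `i < j` and the operations strictly between
them are well-nested. -/
def Matching (δ : Fin n → Transition Q A Γ X ℐ) (i j : Fin n) : Prop :=
  i < j ∧ (δ i).op.isPush = true ∧ (δ j).op.isPop = true ∧ WellNested δ (i.val + 1) j.val

/-- The points of the TCW of a run, where block `i` has `h i` guard points and `g i` reset
points: `ℓ_i`, `ℓ_i^t`, `p_i`, `r_i^s`, `r_i`. There is no `p_0`; `action k` is `p_{k+1}`. -/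
inductive RunPoint (n : ℕ) (h g : Fin (n + 1) → ℕ) : Type
  | left (i : Fin (n + 1)) : RunPoint n h g
  | guard (i : Fin (n + 1)) (t : Fin (h i)) : RunPoint n h g
  | action (k : Fin n) : RunPoint n h g
  | reset (i : Fin (n + 1)) (s : Fin (g i)) : RunPoint n h g
  | right (i : Fin (n + 1)) : RunPoint n h g

/-- The points are ordered lexicographically by these keys: block by block, and within a block
`ℓ_i → ℓ_i^1 → ⋯ → ℓ_i^{h_i} → p_i → r_i^1 → ⋯ → r_i^{g_i} → r_i`. -/
def RunPoint.key {h g : Fin (n + 1) → ℕ} : RunPoint n h g → ℕ ×ₗ ℕ ×ₗ ℕ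
  | .left i => toLex (i.val, toLex (0, 0))
  | .guard i t => toLex (i.val, toLex (1, t.val))
  | .action k => toLex (k.val + 1, toLex (2, 0))
  | .reset i s => toLex (i.val, toLex (3, s.val))
  | .right i => toLex (i.val, toLex (4, 0))

/-- The label of a point: the letter of the transition on `p_i`, silent elsewhere. -/
def RunPoint.letter (δ : Fin n → Transition Q A Γ X ℐ) {h g : Fin (n + 1) → ℕ} :
    RunPoint n h g → Option A
  | .action k => some (δ k).letter
  | _ => none

/-- The `t`-th conjunct of the guard of block `j` is `x ∈ I`, and block `i` is the last block
before `j` in which `x` is reset. -/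
def LastReset (δ : Fin n → Transition Q A Γ X ℐ) (x : X) (I : ℐ.Elem) (i j : Fin (n + 1))
    (t : Fin (blockGuard δ j).length) : Prop :=
  i < j ∧ (blockGuard δ j).get t = (x, I) ∧ x ∈ blockResets δ i ∧
    ∀ k, i < k → k < j → x ∉ blockResets δ k

variable {V : Type*} [LinearOrder V]

/-- The TCW `W` arises from the accepting run with states `σ` and transitions `δ`, where
`g i` is the number of reset points of block `i`, `pos` identifies the points of the run with the
positions of `W`, and `clk x I` is the relation of the timing constraints `x ∈ I` of clock `x`. -/
structure IsGeneratedBy (S : TPDA Q A Γ X ℐ) (W : TCW A ℐ V)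
    (σ : Fin (n + 1) → Q) (δ : Fin n → Transition Q A Γ X ℐ) (g : Fin (n + 1) → ℕ)
    (pos : RunPoint n (fun i => (blockGuard δ i).length) g → V)
    (clk : X → ℐ.Elem → V → V → Prop) : Prop where
  /- an accepting abstract run -/
  start : σ 0 = S.init
  trans_mem : ∀ k, δ k ∈ S.trans
  src_eq : ∀ k, (δ k).src = σ k.castSucc
  tgt_eq : ∀ k, (δ k).tgt = σ k.succ
  accept : σ (Fin.last n) ∈ S.final
  /- the stack discipline -/
  nested : WellNested δ 0 n
  symbol_eq : ∀ i j b c I, Matching δ i j → (δ i).op = .push b → (δ j).op = .pop c I → b = c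
  /- positions, their order and labels -/
  pos_bijective : Function.Bijective pos
  pos_lt : ∀ a b, pos a < pos b ↔ a.key < b.key
  label_eq : ∀ a, W.label (pos a) = a.letter δ
  /- the timing constraints: those of the extra clock, of the stack, and of the clocks in `X` -/
  constr_iff : ∀ I u v, W.constr I u v ↔
    (I = ℐ.zero ∧ ∃ i, u = pos (.left i) ∧ v = pos (.right i)) ∨
    (∃ i j b, Matching δ i j ∧ (δ i).op = .push b ∧ (δ j).op = .pop b I ∧
      u = pos (.action i) ∧ v = pos (.action j)) ∨
    (∃ x, clk x I u v)
  clk_sound : ∀ x I u v, clk x I u v → ∃ i j s t,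
    LastReset δ x I i j t ∧ u = pos (.reset i s) ∧ v = pos (.guard j t)
  clk_complete : ∀ x I i j t, LastReset δ x I i j t →
    ∃ s, clk x I (pos (.reset i s)) (pos (.guard j t))
  /- every reset point is the source of a constraint on a clock reset in its block -/
  reset_used : ∀ i s, ∃ x ∈ blockResets δ i, ∃ I v, clk x I (pos (.reset i s)) v
  /- the reset points of a block are grouped by clocks -/
  grouped : ∀ i (s u t : Fin (g i)) x, s < u → u < t →
    (∃ I v, clk x I (pos (.reset i s)) v) → (∃ I v, clk x I (pos (.reset i t)) v) →
    ∃ I v, clk x I (pos (.reset i u)) v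
  /- the constraints of one clock with sources in the same block are well-nested -/
  clk_nested : ∀ x I I' i (s s' : Fin (g i)) v v',
    clk x I (pos (.reset i s)) v → clk x I' (pos (.reset i s')) v' → s < s' →
    pos (.reset i s') < v' ∧ v' < v

/-- The simple TCWs on `V` generated by `S`. -/
def TPDA.stcw (S : TPDA Q A Γ X ℐ) (V : Type*) [LinearOrder V] : Set (TCW A ℐ V) :=
  {W | W.IsSimple ∧ ∃ (n : ℕ) (σ : Fin (n + 1) → Q) (δ : Fin n → Transition Q A Γ X ℐ)
    (g : Fin (n + 1) → ℕ) (pos : RunPoint n (fun i => (blockGuard δ i).length) g → V)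
    (clk : X → ℐ.Elem → V → V → Prop), IsGeneratedBy S W σ δ g pos clk}

end Run

/-! A simple TCW is a matching: each point is isolated or lies on exactly one timing constraint.
Attach every constraint to its target. A set `J` of positions then owns `targetPreimage R J`: its
isolated points and its targets, together with the sources of those targets, wherever they lie.
Disjoint sets own unrelated points, so cutting `J` in two is always a legal split of what it owns,
and only the number of blocks has to be controlled.

Let `J` be an interval such that no stack pair has exactly one end in `J`. What `J` owns differs
from `J` by two sets for each clock: the sources in `J` with target outside, which are lost, and the
sources outside `J` with target inside, which are gained. Constraints of one clock that overlap
start in the same block of the run, where they are grouped and nested; hence both sets are intervals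
(`ordConnected_inner`, `ordConnected_outer`). Each costs at most one block. With `c = |X| + 1`
clocks, counting the extra one that relates the two ends of a block, `J` owns at most `2c + 1`
blocks, and at most `c + 1` if `J` is a prefix, since then nothing is gained.

For a timed automaton, repeatedly remove the last position of a prefix. The removed part has at most
2 blocks, so `(c + 1) + 2 = |X| + 4` suffice. For a TPDA, if the last position of the interval is
the target of a stack pair, split the interval at the matching push, for a total of `2(2c + 1) =
4|X| + 6` blocks, or remove the pair if the push comes first; otherwise remove the last position.

`IsFragment.hasTree` turns such a decomposition of sets into moves of the split-game. -/

/-! ### Counting blocks of a set of positions -/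

section Starts

variable {V : Type*} [LinearOrder V]

open Classical in
/-- The points of `s` whose immediate predecessor is not in `s`: the first points of the blocks
of `s`. -/
noncomputable def Finset.starts (s : Finset V) : Finset V := s.filter fun v => ∀ u ∈ s, ¬ u ⋖ v

lemma Finset.mem_starts {s : Finset V} {v : V} : v ∈ s.starts ↔ v ∈ s ∧ ∀ u ∈ s, ¬ u ⋖ v := by
  simp [Finset.starts]

lemma Finset.card_starts_le_card (s : Finset V) : s.starts.card ≤ s.card :=
  Finset.card_le_card fun _ hv => (Finset.mem_starts.1 hv).1

lemma Finset.card_starts_union_le (s t : Finset V) :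
    (s ∪ t).starts.card ≤ s.starts.card + t.starts.card := by
  refine (Finset.card_le_card ?_).trans (Finset.card_union_le _ _)
  intro v hv
  simp only [Finset.mem_starts, Finset.mem_union] at hv ⊢
  grind

lemma Finset.card_starts_biUnion_le {ι : Type*} (c : Finset ι) (f : ι → Finset V)
    (hf : ∀ i ∈ c, (f i).starts.card ≤ 1) : (c.biUnion f).starts.card ≤ c.card := by
  classical
  induction c using Finset.induction_on with
  | empty => simp [Finset.starts]
  | insert a c ha ih =>
    rw [Finset.biUnion_insert, Finset.card_insert_of_notMem ha]
    have h1 := Finset.card_starts_union_le (f a) (c.biUnion f)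
    have h2 := hf a (Finset.mem_insert_self _ _)
    have h3 := ih fun i hi => hf i (Finset.mem_insert_of_mem hi)
    omega

variable [Fintype V]

lemma Finset.card_starts_le_one {s : Finset V} (hs : (s : Set V).OrdConnected) :
    s.starts.card ≤ 1 := by
  have key : ∀ u ∈ s.starts, ∀ v ∈ s.starts, ¬ u < v := by
    intro u hu v hv huv
    rw [Finset.mem_starts] at hu hv
    obtain ⟨w, hw, hwv⟩ := exists_le_covBy_of_lt huv
    exact hv.2 w (Finset.mem_coe.1 (hs.out hu.1 hv.1 ⟨hw, hwv.le⟩)) hwv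
  refine Finset.card_le_one.2 fun u hu v hv => ?_
  exact le_antisymm (not_lt.1 (key v hv u hu)) (not_lt.1 (key u hu v hv))

/-- Removing an interval creates at most one new block start, the point immediately after the
interval. -/
lemma Finset.card_starts_sdiff_le (s : Finset V) {t : Finset V} (ht : (t : Set V).OrdConnected) :
    (s \ t).starts.card ≤ s.starts.card + 1 := by
  classical
  let e : Finset V := Finset.univ.filter fun v => v ∉ t ∧ ∃ u ∈ t, u ⋖ v
  have he : e.card ≤ 1 := by
    have key : ∀ v ∈ e, ∀ v' ∈ e, ¬ v < v' := by
      intro v hv v' hv' hlt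
      simp only [e, Finset.mem_filter, Finset.mem_univ, true_and] at hv hv'
      obtain ⟨hvt, u, hu, huv⟩ := hv
      obtain ⟨-, u', hu', huv'⟩ := hv'
      exact hvt (Finset.mem_coe.1 (ht.out hu hu' ⟨huv.le, huv'.le_of_lt hlt⟩))
    refine Finset.card_le_one.2 fun u hu v hv => ?_
    exact le_antisymm (not_lt.1 (key v hv u hu)) (not_lt.1 (key u hu v hv))
  have hsub : (s \ t).starts ⊆ s.starts ∪ e := by
    intro v hv
    simp only [Finset.mem_starts, Finset.mem_union, Finset.mem_sdiff, e, Finset.mem_filter,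
      Finset.mem_univ, true_and] at hv ⊢
    grind
  have := (Finset.card_le_card hsub).trans (Finset.card_union_le _ _)
  omega

lemma Finset.card_starts_sdiff_biUnion_le {ι : Type*} (s : Finset V) (c : Finset ι)
    (f : ι → Finset V) (hf : ∀ i ∈ c, (f i : Set V).OrdConnected) :
    (s \ c.biUnion f).starts.card ≤ s.starts.card + c.card := by
  classical
  induction c using Finset.induction_on with
  | empty => simp
  | insert a c ha ih =>
    rw [Finset.biUnion_insert, Finset.card_insert_of_notMem ha, Finset.union_comm,
      ← Finset.sup_eq_union, ← sdiff_sdiff_left]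
    have h1 := Finset.card_starts_sdiff_le (s \ c.biUnion f) (hf a (Finset.mem_insert_self _ _))
    have h3 := ih fun i hi => hf i (Finset.mem_insert_of_mem hi)
    omega

end Starts

/-! ### Decompositions of sets, without successor edges -/

/-- `s` can be decomposed into single points and `R`-related pairs by repeatedly splitting it
into two unrelated parts that have together at most `K` blocks. -/
inductive Decomposable {V : Type*} [LinearOrder V] (R : V → V → Prop) (K : ℕ) : Finset V → Prop
  | single (p : V) : Decomposable R K {p}
  | pair (p q : V) (h : R p q) : Decomposable R K {p, q}
  | union (s t : Finset V) (hs : s.Nonempty) (ht : t.Nonempty) (hst : Disjoint s t)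
      (hR : ∀ u ∈ s, ∀ v ∈ t, ¬ R u v ∧ ¬ R v u) (hK : s.starts.card + t.starts.card ≤ K)
      (ds : Decomposable R K s) (dt : Decomposable R K t) : Decomposable R K (s ∪ t)

/-! ### The points owned by a set of positions -/

section Segments

variable {V : Type*} [LinearOrder V] [Fintype V]

/-- Every point is in at most one of the pairs of `R`, and these are increasing. -/
structure IsOrderedMatching (R : V → V → Prop) : Prop where
  lt : ∀ {u v}, R u v → u < v
  right_unique : ∀ {u v v'}, R u v → R u v' → v = v'
  left_unique : ∀ {u u' v}, R u v → R u' v → u = u'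
  not_both : ∀ {u v w}, R u v → ¬ R v w

open Classical in
/-- The points of `J` which are not sources, together with the sources of the points of `J`. -/
noncomputable def targetPreimage (R : V → V → Prop) (J : Finset V) : Finset V :=
  Finset.univ.filter fun w => (∃ v ∈ J, R w v) ∨ (w ∈ J ∧ ∀ v, ¬ R w v)

variable {R : V → V → Prop}

lemma mem_targetPreimage {J : Finset V} {w : V} :
    w ∈ targetPreimage R J ↔ (∃ v ∈ J, R w v) ∨ (w ∈ J ∧ ∀ v, ¬ R w v) := by
  simp [targetPreimage]

lemma targetPreimage_union (J J' : Finset V) :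
    targetPreimage R (J ∪ J') = targetPreimage R J ∪ targetPreimage R J' := by
  ext w
  simp only [mem_targetPreimage, Finset.mem_union]
  grind

lemma targetPreimage_empty : targetPreimage R ∅ = ∅ := by
  ext w
  simp [mem_targetPreimage]

lemma targetPreimage_univ : targetPreimage R Finset.univ = Finset.univ := by
  ext w
  simp only [mem_targetPreimage, Finset.mem_univ, true_and, iff_true]
  grind

lemma IsOrderedMatching.disjoint_targetPreimage (hR : IsOrderedMatching R) {J J' : Finset V}
    (h : Disjoint J J') : Disjoint (targetPreimage R J) (targetPreimage R J') := by
  rw [Finset.disjoint_left] at h ⊢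
  intro w h1 h2
  rw [mem_targetPreimage] at h1 h2
  rcases h1 with ⟨v, hv, hwv⟩ | ⟨hw, hn⟩ <;> rcases h2 with ⟨v', hv', hwv'⟩ | ⟨hw', hn'⟩
  · exact h hv (hR.right_unique hwv hwv' ▸ hv')
  · exact hn' _ hwv
  · exact hn _ hwv'
  · exact h hw hw'

lemma IsOrderedMatching.not_rel_targetPreimage (hR : IsOrderedMatching R) {J J' : Finset V}
    (h : Disjoint J J') {u v : V} (hu : u ∈ targetPreimage R J) (hv : v ∈ targetPreimage R J') :
    ¬ R u v := by
  intro huv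
  rw [Finset.disjoint_left] at h
  rw [mem_targetPreimage] at hu hv
  rcases hu with ⟨w, hw, huw⟩ | ⟨-, hn⟩
  · rcases hv with ⟨w', -, hvw⟩ | ⟨hv, -⟩
    · exact hR.not_both huv hvw
    · exact h hw (hR.right_unique huv huw ▸ hv)
  · exact hn _ huv

/-- A part may own nothing, namely when it consists of sources whose targets lie elsewhere. Such a
part is skipped, which is why the assumptions on the parts are conditional on nonemptiness. -/
lemma IsOrderedMatching.decomposable_union (hR : IsOrderedMatching R) {K : ℕ} {J J' : Finset V}
    (h : Disjoint J J')
    (hK : (targetPreimage R J).starts.card + (targetPreimage R J').starts.card ≤ K)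
    (hJ : (targetPreimage R J).Nonempty → Decomposable R K (targetPreimage R J))
    (hJ' : (targetPreimage R J').Nonempty → Decomposable R K (targetPreimage R J'))
    (hne : (targetPreimage R (J ∪ J')).Nonempty) :
    Decomposable R K (targetPreimage R (J ∪ J')) := by
  rw [targetPreimage_union] at hne ⊢
  rcases (targetPreimage R J).eq_empty_or_nonempty with h1 | h1
  · rw [h1, Finset.empty_union] at hne ⊢
    exact hJ' hne
  rcases (targetPreimage R J').eq_empty_or_nonempty with h2 | h2
  · rw [h2, Finset.union_empty]
    exact hJ h1
  exact .union _ _ h1 h2 (hR.disjoint_targetPreimage h)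
    (fun u hu v hv => ⟨hR.not_rel_targetPreimage h hu hv,
      hR.not_rel_targetPreimage h.symm hv hu⟩) hK (hJ h1) (hJ' h2)

lemma IsOrderedMatching.targetPreimage_singleton_of_rel (hR : IsOrderedMatching R) {u v : V}
    (h : R u v) : targetPreimage R {v} = {u, v} := by
  ext w
  simp only [mem_targetPreimage, Finset.mem_singleton, exists_eq_left, Finset.mem_insert]
  constructor
  · rintro (h1 | h1)
    · exact .inl (hR.left_unique h1 h)
    · exact .inr h1.1
  · rintro (rfl | rfl)
    · exact .inl h
    · exact .inr ⟨rfl, fun _ => hR.not_both h⟩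

lemma targetPreimage_singleton_of_not_rel {v : V} (h : ∀ u, ¬ R u v) :
    targetPreimage R {v} ⊆ {v} := by
  intro w hw
  simp only [mem_targetPreimage, Finset.mem_singleton, exists_eq_left] at hw ⊢
  grind

lemma IsOrderedMatching.targetPreimage_singleton (hR : IsOrderedMatching R) (K : ℕ) (v : V) :
    (targetPreimage R {v}).starts.card ≤ 2 ∧
      ((targetPreimage R {v}).Nonempty → Decomposable R K (targetPreimage R {v})) := by
  by_cases h : ∃ u, R u v
  · obtain ⟨u, hu⟩ := h
    rw [hR.targetPreimage_singleton_of_rel hu]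
    exact ⟨(Finset.card_starts_le_card _).trans Finset.card_le_two, fun _ => .pair u v hu⟩
  · push Not at h
    have hs := targetPreimage_singleton_of_not_rel h
    refine ⟨((Finset.card_starts_le_card _).trans (Finset.card_le_card hs)).trans (by simp), ?_⟩
    intro hne
    rw [hne.subset_singleton_iff.1 hs]
    exact .single v

/-! ### Block bounds and decompositions for clocks and a stack -/

/-- Two constraints of the same clock that overlap are nested, and every point between their
sources is the source of a constraint nested between them. -/
def IsGroupedNested (R : V → V → Prop) : Prop :=
  ∀ ⦃u v a b⦄, R u v → R a b → u < a → a < v →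
    ∀ w, u < w → w < a → ∃ z, R w z ∧ b < z ∧ z < v

/-- A matching composed of the constraints of finitely many clocks and of the pairs of a
well-nested relation. -/
structure IsClockStackMatching {C : Type*} (R : V → V → Prop) (clock : C → V → V → Prop)
    (stack : V → V → Prop) : Prop extends IsOrderedMatching R where
  rel_iff : ∀ u v, R u v ↔ (∃ c, clock c u v) ∨ stack u v
  grouped : ∀ c, IsGroupedNested (clock c)
  nested : ∀ {u v u' v'}, stack u v → stack u' v' → u < u' → u' < v → v' < v

namespace IsClockStackMatching

variable {C : Type*} {clock : C → V → V → Prop} {stack : V → V → Prop}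

open Classical in
lemma targetPreimage_eq [Fintype C] (h : IsClockStackMatching R clock stack) {J : Finset V}
    (hs : ∀ u v, stack u v → (u ∈ J ↔ v ∈ J)) :
    targetPreimage R J =
      (J \ Finset.univ.biUnion fun c => J.filter fun u => ∃ v, v ∉ J ∧ clock c u v) ∪
        Finset.univ.biUnion fun c =>
          Finset.univ.filter fun u => u ∉ J ∧ ∃ v, v ∈ J ∧ clock c u v := by
  ext w
  simp only [mem_targetPreimage, Finset.mem_union, Finset.mem_sdiff, Finset.mem_biUnion,
    Finset.mem_univ, true_and, Finset.mem_filter, not_exists, not_and]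
  constructor
  · rintro (⟨v, hv, hwv⟩ | ⟨hw, hn⟩)
    · by_cases hw : w ∈ J
      · refine .inl ⟨hw, fun c _ z hz hc => hz ?_⟩
        rwa [h.right_unique ((h.rel_iff _ _).2 (.inl ⟨c, hc⟩)) hwv]
      · rcases (h.rel_iff _ _).1 hwv with ⟨c, hc⟩ | hst
        · exact .inr ⟨c, hw, v, hv, hc⟩
        · exact absurd ((hs _ _ hst).2 hv) hw
    · exact .inl ⟨hw, fun c _ z _ hc => hn z ((h.rel_iff _ _).2 (.inl ⟨c, hc⟩))⟩
  · rintro (⟨hw, hn⟩ | ⟨c, -, v, hv, hc⟩)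
    · by_cases hex : ∃ v, R w v
      · obtain ⟨v, hv⟩ := hex
        refine .inl ⟨v, ?_, hv⟩
        rcases (h.rel_iff _ _).1 hv with ⟨c, hc⟩ | hst
        · by_contra hvJ
          exact hn c hw v hvJ hc
        · exact (hs _ _ hst).1 hw
      · exact .inr ⟨hw, not_exists.1 hex⟩
    · exact .inl ⟨v, hv, (h.rel_iff _ _).2 (.inl ⟨c, hc⟩)⟩

-- The lost sources have their target outside `J`, so they start in `J`. If `u < u'` are two of
-- them, the target of `u` lies beyond `u'` by convexity, so the constraints overlap. A point
-- between is then the source of a constraint ending beyond the target of `u'`, hence again outside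
-- `J`.
open Classical in
lemma ordConnected_inner (h : IsClockStackMatching R clock stack) {J : Finset V}
    (hJ : (J : Set V).OrdConnected) (c : C) :
    ((J.filter fun u => ∃ v, v ∉ J ∧ clock c u v : Finset V) : Set V).OrdConnected := by
  have hlt : ∀ {a b}, clock c a b → a < b := fun hc => h.lt ((h.rel_iff _ _).2 (.inl ⟨c, hc⟩))
  have hJ' : ∀ {a b z}, a ∈ J → b ∈ J → a ≤ z → z ≤ b → z ∈ J := fun ha hb h1 h2 =>
    Finset.mem_coe.1 (hJ.out ha hb ⟨h1, h2⟩)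
  refine ⟨fun u hu u' hu' w hw => ?_⟩
  rcases hw.1.eq_or_lt with rfl | h1
  · exact hu
  rcases hw.2.eq_or_lt with rfl | h2
  · exact hu'
  simp only [Finset.coe_filter, Set.mem_ofPred_eq] at hu hu' ⊢
  obtain ⟨huJ, v, hv, huv⟩ := hu
  obtain ⟨huJ', v', hv', huv'⟩ := hu'
  have huv1 : u' < v := by
    by_contra hle
    exact hv (hJ' huJ huJ' (hlt huv).le (not_lt.1 hle))
  obtain ⟨z, hz, hz1, hz2⟩ := h.grouped c huv huv' (h1.trans h2) huv1 w h1 h2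
  exact ⟨hJ' huJ huJ' h1.le h2.le, z, fun hzJ => hv' (hJ' huJ' hzJ (hlt huv').le hz1.le), hz⟩

-- If `u < u'` are gained sources, then `u'` precedes the target of `u`, since otherwise it would
-- lie between two points of `J`. The constraints overlap, and one starting between them ends
-- between their targets, hence in `J`.
open Classical in
lemma ordConnected_outer (h : IsClockStackMatching R clock stack) {J : Finset V}
    (hJ : (J : Set V).OrdConnected) (c : C) :
    ((Finset.univ.filter fun u => u ∉ J ∧ ∃ v, v ∈ J ∧ clock c u v : Finset V) :
      Set V).OrdConnected := by
  have hlt : ∀ {a b}, clock c a b → a < b := fun hc => h.lt ((h.rel_iff _ _).2 (.inl ⟨c, hc⟩))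
  have hJ' : ∀ {a b z}, a ∈ J → b ∈ J → a ≤ z → z ≤ b → z ∈ J := fun ha hb h1 h2 =>
    Finset.mem_coe.1 (hJ.out ha hb ⟨h1, h2⟩)
  refine ⟨fun u hu u' hu' w hw => ?_⟩
  rcases hw.1.eq_or_lt with rfl | h1
  · exact hu
  rcases hw.2.eq_or_lt with rfl | h2
  · exact hu'
  simp only [Finset.coe_filter, Set.mem_ofPred_eq, Finset.mem_univ, true_and] at hu hu' ⊢
  obtain ⟨huJ, v, hv, huv⟩ := hu
  obtain ⟨huJ', v', hv', huv'⟩ := hu'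
  have huv1 : u' < v := by
    by_contra hle
    exact huJ' (hJ' hv hv' (not_lt.1 hle) (hlt huv').le)
  obtain ⟨z, hz, hz1, hz2⟩ := h.grouped c huv huv' (h1.trans h2) huv1 w h1 h2
  exact ⟨fun hwJ => huJ' (hJ' hwJ hv h2.le huv1.le), z, hJ' hv' hv hz1.le hz2.le, hz⟩

lemma card_starts_le [Fintype C] (h : IsClockStackMatching R clock stack) {J : Finset V}
    (hJ : (J : Set V).OrdConnected) (hs : ∀ u v, stack u v → (u ∈ J ↔ v ∈ J)) :
    (targetPreimage R J).starts.card ≤ 2 * Fintype.card C + 1 := by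
  classical
  rw [h.targetPreimage_eq hs]
  refine (Finset.card_starts_union_le _ _).trans ?_
  have h1 := Finset.card_starts_sdiff_biUnion_le J Finset.univ _
    (fun c _ => h.ordConnected_inner hJ c)
  have h2 := Finset.card_starts_biUnion_le Finset.univ _
    (fun c _ => Finset.card_starts_le_one (h.ordConnected_outer hJ c))
  have h3 := Finset.card_starts_le_one hJ
  rw [Finset.card_univ] at h1 h2
  omega

/-- A source precedes its target, so a prefix gains no sources from outside; this saves one block
per clock. -/
lemma card_starts_le_of_isLowerSet [Fintype C] (h : IsClockStackMatching R clock stack)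
    {J : Finset V} (hJ : IsLowerSet (J : Set V)) (hs : ∀ u v, stack u v → (u ∈ J ↔ v ∈ J)) :
    (targetPreimage R J).starts.card ≤ Fintype.card C + 1 := by
  classical
  rw [h.targetPreimage_eq hs]
  have h1 := Finset.card_starts_sdiff_biUnion_le J Finset.univ _
    (fun c _ => h.ordConnected_inner hJ.ordConnected c)
  have h3 := Finset.card_starts_le_one hJ.ordConnected
  have h4 : (Finset.univ.biUnion fun c => Finset.univ.filter
      fun u => u ∉ J ∧ ∃ v, v ∈ J ∧ clock c u v) = ∅ := by
    refine Finset.eq_empty_of_forall_notMem fun w hw => ?_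
    simp only [Finset.mem_biUnion, Finset.mem_univ, true_and, Finset.mem_filter] at hw
    obtain ⟨c, hw, v, hv, hc⟩ := hw
    exact hw (hJ (h.lt ((h.rel_iff _ _).2 (.inl ⟨c, hc⟩))).le hv)
  rw [h4, Finset.union_empty]
  rw [Finset.card_univ] at h1
  omega

theorem decomposable_of_isLowerSet [Fintype C] (h : IsClockStackMatching R clock stack)
    (hs : ∀ u v, ¬ stack u v) (J : Finset V) (hJ : IsLowerSet (J : Set V))
    (hne : (targetPreimage R J).Nonempty) :
    Decomposable R (Fintype.card C + 3) (targetPreimage R J) := by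
  classical
  induction J using Finset.induction_on_max with
  | empty => simp [targetPreimage_empty] at hne
  | insert v J hv ih =>
    have hvJ : v ∉ J := fun hm => lt_irrefl _ (hv v hm)
    have hJ' : IsLowerSet (J : Set V) := by
      intro a b hba ha
      have hb : b ∈ insert v J :=
        Finset.mem_coe.1 (hJ hba (Finset.mem_coe.2 (Finset.mem_insert_of_mem ha)))
      rcases Finset.mem_insert.1 hb with rfl | hb
      · exact absurd (hv a ha) (not_lt.2 hba)
      · exact hb
    obtain ⟨h1, h2⟩ := h.targetPreimage_singleton (Fintype.card C + 3) v
    have h3 := h.card_starts_le_of_isLowerSet hJ' fun u v huv => absurd huv (hs u v)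
    rw [Finset.insert_eq] at hne ⊢
    exact h.decomposable_union (by simpa using hvJ) (by omega) h2 (ih hJ') hne

theorem decomposable_of_ordConnected [Fintype C] [Nonempty C]
    (h : IsClockStackMatching R clock stack)
    (J : Finset V) (hJ : (J : Set V).OrdConnected) (hs : ∀ u v, stack u v → (u ∈ J ↔ v ∈ J))
    (hne : (targetPreimage R J).Nonempty) :
    Decomposable R (4 * Fintype.card C + 2) (targetPreimage R J) := by
  classical
  -- Removing a single component costs `2 + (2c + 1)` blocks, which is at most `4c + 2` only for `c
  -- > 0`.
  have hC : 0 < Fintype.card C := Fintype.card_pos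
  have hRs : ∀ {u v}, stack u v → R u v := fun huv => (h.rel_iff _ _).2 (.inr huv)
  induction J using Finset.strongInduction with
  | H J ih =>
  rcases J.eq_empty_or_nonempty with rfl | hJne
  · simp [targetPreimage_empty] at hne
  have hmem : ∀ {a b z}, a ∈ J → b ∈ J → a ≤ z → z ≤ b → z ∈ J := fun ha hb h1 h2 =>
    Finset.mem_coe.1 (hJ.out ha hb ⟨h1, h2⟩)
  obtain ⟨v, hvJ, hv⟩ : ∃ v ∈ J, ∀ w ∈ J, w ≤ v :=
    ⟨J.max' hJne, J.max'_mem hJne, fun w hw => J.le_max' w hw⟩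
  -- The last point of `J` is not a push: its matching pop would be a later point of `J`.
  have hvns : ∀ w, ¬ stack v w := fun w hw =>
    absurd (h.lt (hRs hw)) (not_lt.2 (hv w ((hs _ _ hw).1 hvJ)))
  by_cases hst : ∃ u, stack u v
  · obtain ⟨u, huv⟩ := hst
    have huJ := (hs _ _ huv).2 hvJ
    have hult := h.lt (hRs huv)
    by_cases hmin : ∃ z ∈ J, z < u
    · -- split at the matching push
      obtain ⟨z, hzJ, hzu⟩ := hmin
      have hJeq : J = J.filter (· < u) ∪ J.filter (u ≤ ·) := by
        ext w
        simp only [Finset.mem_union, Finset.mem_filter]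
        have := lt_or_ge w u
        tauto
      have hdis : Disjoint (J.filter (· < u)) (J.filter (u ≤ ·)) := by
        rw [Finset.disjoint_left]
        intro w h1 h2
        exact absurd (Finset.mem_filter.1 h1).2 (not_lt.2 (Finset.mem_filter.1 h2).2)
      have c1 : ((J.filter (· < u) : Finset V) : Set V).OrdConnected := by
        refine ⟨fun a ha b hb w hw => ?_⟩
        simp only [Finset.coe_filter, Set.mem_ofPred_eq] at ha hb ⊢
        exact ⟨hmem ha.1 hb.1 hw.1 hw.2, hw.2.trans_lt hb.2⟩
      have c2 : ((J.filter (u ≤ ·) : Finset V) : Set V).OrdConnected := by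
        refine ⟨fun a ha b hb w hw => ?_⟩
        simp only [Finset.coe_filter, Set.mem_ofPred_eq] at ha hb ⊢
        exact ⟨hmem ha.1 hb.1 hw.1 hw.2, ha.2.trans hw.1⟩
      -- A stack pair straddling `u` would, by nesting, end after `v`, the last point of `J`. So
      -- both halves still respect the stack.
      have hcross : ∀ a b, stack a b → b ∈ J → (a < u ↔ b < u) := by
        intro a b hab hbJ
        refine ⟨fun hau => ?_, fun hbu => (h.lt (hRs hab)).trans hbu⟩
        by_contra hbu
        rcases (not_lt.1 hbu).eq_or_lt with rfl | hub
        · exact h.not_both (hRs hab) (hRs huv)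
        · exact absurd (h.nested hab huv hau hub) (not_lt.2 (hv b hbJ))
      have s1 : ∀ a b, stack a b → (a ∈ J.filter (· < u) ↔ b ∈ J.filter (· < u)) := by
        intro a b hab
        have := hs a b hab
        have := hcross a b hab
        simp only [Finset.mem_filter]
        tauto
      have s2 : ∀ a b, stack a b → (a ∈ J.filter (u ≤ ·) ↔ b ∈ J.filter (u ≤ ·)) := by
        intro a b hab
        have := hs a b hab
        have := hcross a b hab
        simp only [Finset.mem_filter, ← not_lt]
        tauto
      have l1 : J.filter (· < u) ⊂ J :=
        Finset.filter_ssubset.2 ⟨u, huJ, lt_irrefl _⟩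
      have l2 : J.filter (u ≤ ·) ⊂ J :=
        Finset.filter_ssubset.2 ⟨z, hzJ, not_le.2 hzu⟩
      have b1 := h.card_starts_le c1 s1
      have b2 := h.card_starts_le c2 s2
      rw [hJeq] at hne ⊢
      exact h.decomposable_union hdis (by omega) (ih _ l1 c1 s1) (ih _ l2 c2 s2) hne
    · -- remove the outer pair
      push Not at hmin
      have hJeq : J = {u, v} ∪ J \ {u, v} := by
        ext w
        simp only [Finset.mem_union, Finset.mem_sdiff, Finset.mem_insert, Finset.mem_singleton]
        by_cases h1 : w = u
        · simp [h1, huJ]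
        by_cases h2 : w = v
        · simp [h2, hvJ]
        simp [h1, h2]
      have hdis : Disjoint {u, v} (J \ {u, v}) := Finset.disjoint_sdiff
      have c : ((J \ {u, v} : Finset V) : Set V).OrdConnected := by
        refine ⟨fun a ha b hb w hw => ?_⟩
        simp only [Finset.coe_sdiff, Set.mem_sdiff, Finset.mem_coe, Finset.mem_insert,
          Finset.mem_singleton, not_or] at ha hb ⊢
        refine ⟨hmem ha.1 hb.1 hw.1 hw.2, ?_, ?_⟩
        · rintro rfl
          exact ha.2.1 (le_antisymm hw.1 (hmin a ha.1))
        · rintro rfl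
          exact hb.2.2 (le_antisymm (hv b hb.1) hw.2)
      have s : ∀ a b, stack a b → (a ∈ J \ {u, v} ↔ b ∈ J \ {u, v}) := by
        intro a b hab
        have h0 := hs a b hab
        have h1 : a = u ↔ b = v := by
          constructor
          · rintro rfl
            exact h.right_unique (hRs hab) (hRs huv)
          · rintro rfl
            exact h.left_unique (hRs hab) (hRs huv)
        have h2 : a ≠ v := by
          rintro rfl
          exact hvns _ hab
        have h3 : b ≠ u := by
          rintro rfl
          exact h.not_both (hRs hab) (hRs huv)
        simp only [Finset.mem_sdiff, Finset.mem_insert, Finset.mem_singleton]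
        tauto
      have l : J \ {u, v} ⊂ J := by
        refine Finset.sdiff_ssubset ?_ ⟨u, by simp⟩
        intro w hw
        rcases Finset.mem_insert.1 hw with rfl | hw
        · exact huJ
        · rwa [Finset.mem_singleton.1 hw]
      -- The source `u` owns nothing by itself; the whole pair is owned by its target `v`.
      have e : targetPreimage R {u, v} = {u, v} := by
        have e1 : targetPreimage R {u} = ∅ := by
          refine Finset.eq_empty_of_forall_notMem fun w hw => ?_
          simp only [mem_targetPreimage, Finset.mem_singleton, exists_eq_left] at hw
          rcases hw with hw | ⟨rfl, hw⟩
          · exact h.not_both hw (hRs huv)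
          · exact hw _ (hRs huv)
        rw [Finset.insert_eq, targetPreimage_union, e1, Finset.empty_union,
          h.targetPreimage_singleton_of_rel (hRs huv), Finset.insert_eq]
      have b1 : (targetPreimage R {u, v}).starts.card ≤ 2 := by
        rw [e]
        exact (Finset.card_starts_le_card _).trans Finset.card_le_two
      have b2 := h.card_starts_le c s
      rw [hJeq] at hne ⊢
      exact h.decomposable_union hdis (by omega) (fun _ => e.symm ▸ .pair u v (hRs huv))
        (ih _ l c s) hne
  · -- remove the last point
    push Not at hst
    have hJeq : J = {v} ∪ J \ {v} := by
      ext w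
      simp only [Finset.mem_union, Finset.mem_sdiff, Finset.mem_singleton]
      by_cases h2 : w = v
      · simp [h2, hvJ]
      simp [h2]
    have c : ((J \ {v} : Finset V) : Set V).OrdConnected := by
      refine ⟨fun a ha b hb w hw => ?_⟩
      simp only [Finset.coe_sdiff, Set.mem_sdiff, Finset.mem_coe, Finset.mem_singleton] at ha hb ⊢
      refine ⟨hmem ha.1 hb.1 hw.1 hw.2, ?_⟩
      rintro rfl
      exact hb.2 (le_antisymm (hv b hb.1) hw.2)
    have s : ∀ a b, stack a b → (a ∈ J \ {v} ↔ b ∈ J \ {v}) := by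
      intro a b hab
      have h0 := hs a b hab
      have h2 : a ≠ v := by
        rintro rfl
        exact hvns _ hab
      have h3 : b ≠ v := by
        rintro rfl
        exact hst _ hab
      simp only [Finset.mem_sdiff, Finset.mem_singleton]
      tauto
    have l : J \ {v} ⊂ J := Finset.sdiff_ssubset (by simpa using hvJ) ⟨v, by simp⟩
    obtain ⟨b1, d1⟩ := h.targetPreimage_singleton (4 * Fintype.card C + 2) v
    have b2 := h.card_starts_le c s
    rw [hJeq] at hne ⊢
    exact h.decomposable_union Finset.disjoint_sdiff (by omega) d1 (ih _ l c s) hne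

end IsClockStackMatching

end Segments

/-! ### From decompositions to split-trees -/

namespace SplitTCW

variable {A : Type*} {ℐ : IntervalFamily} {V : Type*} [LinearOrder V]

lemma exists_separates {U : SplitTCW A ℐ V} (hne : U.verts.Nonempty) (h : ¬ U.Connected) :
    ∃ s t, U.Separates s t := by
  classical
  simp only [Connected, hne, true_and, not_forall] at h
  obtain ⟨u, hu, v, hv, huv⟩ := h
  refine ⟨U.verts.filter (Relation.EqvGen U.edge u), U.verts.filter (¬ Relation.EqvGen U.edge u ·),
    ⟨u, by simpa [hu] using Relation.EqvGen.refl u⟩, ⟨v, by simp [hv, huv]⟩,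
    Finset.disjoint_filter_filter_not _ _ _, Finset.filter_union_filter_not_eq _ _, ?_⟩
  intro a ha b hb
  rw [Finset.mem_filter] at ha hb
  exact ⟨fun he => hb.2 (ha.2.trans _ _ _ (.rel _ _ he)),
    fun he => hb.2 (ha.2.trans _ _ _ (.symm _ _ (.rel _ _ he)))⟩

lemma Connected.exists_edge_crossing {U : SplitTCW A ℐ V} (h : U.Connected) {u v : V}
    (hu : u ∈ U.verts) (hv : v ∈ U.verts) {s : Finset V} (hus : u ∈ s) (hvs : v ∉ s) :
    ∃ a b, U.edge a b ∧ ¬ (a ∈ s ↔ b ∈ s) := by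
  by_contra! hcon
  have key : ∀ {a b}, Relation.EqvGen U.edge a b → (a ∈ s ↔ b ∈ s) := by
    intro a b hab
    induction hab with
    | rel a b hab => exact hcon a b hab
    | refl a => exact Iff.rfl
    | symm a b _ ih => exact ih.symm
    | trans a b c _ _ ih₁ ih₂ => exact ih₁.trans ih₂
  exact hvs ((key (h.2 u hu v hv)).1 hus)

/-- The width is at most the number of points without an incoming successor edge. -/
lemma width_le_card [Fintype V] {U : SplitTCW A ℐ V} (hne : U.verts.Nonempty) {B : Finset V}
    (hB : ∀ v ∈ U.verts, (∀ u, ¬ U.arc u v) → v ∈ B) : U.width ≤ B.card := by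
  classical
  -- The least point has no incoming edge, yet no hole ends there. It accounts for the 1 in the
  -- definition of `width`; the other points of `B` bound the holes through their right ends.
  have hmin : U.verts.min' hne ∈ B := by
    refine hB _ (U.verts.min'_mem hne) fun u hu => ?_
    obtain ⟨h1, -, h2, -⟩ := U.arc_succ _ _ hu
    exact absurd h2 (not_lt.2 (U.verts.min'_le u h1))
  have hle : Set.ncard {p : V × V | U.hole p.1 p.2} ≤
      ((B.erase (U.verts.min' hne) : Finset V) : Set V).ncard := by
    refine Set.ncard_le_ncard_of_injOn Prod.snd ?_ ?_ (Set.toFinite _)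
    · rintro ⟨u, v⟩ ⟨⟨hu, hv, huv, hno⟩, hna⟩
      refine Finset.mem_coe.2 (Finset.mem_erase.2 ⟨?_, hB v hv fun w hw => ?_⟩)
      · rintro rfl
        exact absurd huv (not_lt.2 (U.verts.min'_le u hu))
      · obtain ⟨h1, -, h2, h3⟩ := U.arc_succ _ _ hw
        rcases lt_trichotomy u w with h | rfl | h
        · exact hno w h1 ⟨h, h2⟩
        · exact hna hw
        · exact h3 u hu ⟨h, huv⟩
    · rintro ⟨u, v⟩ ⟨⟨hu, hv, huv, hno⟩, -⟩ ⟨u', v'⟩ ⟨⟨hu', -, huv', hno'⟩, -⟩ hvv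
      obtain rfl : v = v' := hvv
      rcases lt_trichotomy u u' with h | rfl | h
      · exact absurd ⟨h, huv'⟩ (hno u' hu')
      · rfl
      · exact absurd ⟨h, huv⟩ (hno' u hu)
  rw [Set.ncard_coe_finset, Finset.card_erase_of_mem hmin] at hle
  have : 0 < B.card := Finset.card_pos.2 ⟨_, hmin⟩
  rw [width]
  omega

/-- `U` is a union of connected components of the split word that `W` induces on `s ∪ t` with
some of the successor edges between `s` and `t` removed. -/
structure IsFragment (W : TCW A ℐ V) (s t : Finset V) (U : SplitTCW A ℐ V) : Prop where
  nonempty : U.verts.Nonempty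
  subset : U.verts ⊆ s ∪ t
  constr_iff : ∀ I u v, U.constr I u v ↔ W.constr I u v ∧ u ∈ U.verts ∧ v ∈ U.verts
  constr_closed : ∀ I u v, W.constr I u v → u ∈ s ∪ t → v ∈ s ∪ t →
    u ∈ U.verts ∨ v ∈ U.verts → u ∈ U.verts ∧ v ∈ U.verts
  arc_covBy : ∀ u v, U.arc u v → u ⋖ v
  arc_left : ∀ u v, u ⋖ v → u ∈ s → v ∈ s → u ∈ U.verts ∨ v ∈ U.verts → U.arc u v
  arc_right : ∀ u v, u ⋖ v → u ∈ t → v ∈ t → u ∈ U.verts ∨ v ∈ U.verts → U.arc u v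

namespace IsFragment

variable {W : TCW A ℐ V} {s t : Finset V} {U : SplitTCW A ℐ V}

lemma symm (h : IsFragment W s t U) : IsFragment W t s U where
  nonempty := h.nonempty
  subset := Finset.union_comm s t ▸ h.subset
  constr_iff := h.constr_iff
  constr_closed := Finset.union_comm s t ▸ h.constr_closed
  arc_covBy := h.arc_covBy
  arc_left := h.arc_right
  arc_right := h.arc_left

lemma of_union (h : IsFragment W (s ∪ t) ∅ U) : IsFragment W s t U where
  nonempty := h.nonempty
  subset := Finset.union_empty (s ∪ t) ▸ h.subset
  constr_iff := h.constr_iff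
  constr_closed := by simpa only [Finset.union_empty] using h.constr_closed
  arc_covBy := h.arc_covBy
  arc_left u v huv hu hv :=
    h.arc_left u v huv (Finset.mem_union_left _ hu) (Finset.mem_union_left _ hv)
  arc_right u v huv hu hv :=
    h.arc_left u v huv (Finset.mem_union_right _ hu) (Finset.mem_union_right _ hv)

lemma left_of_subset (h : IsFragment W s t U) (hs : U.verts ⊆ s) : IsFragment W s ∅ U where
  nonempty := h.nonempty
  subset := by simpa only [Finset.union_empty] using hs
  constr_iff := h.constr_iff
  constr_closed I u v huv hu hv := by
    rw [Finset.union_empty] at hu hv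
    exact h.constr_closed I u v huv (Finset.mem_union_left _ hu) (Finset.mem_union_left _ hv)
  arc_covBy := h.arc_covBy
  arc_left := h.arc_left
  arc_right _ _ _ hu := absurd hu (Finset.notMem_empty _)

/-- Successor edges inside `s` or inside `t` are still present at points of `U`, so a point without
incoming edge starts a block of `s` or of `t`. -/
lemma width_le [Fintype V] (h : IsFragment W s t U) : U.width ≤ s.starts.card + t.starts.card := by
  classical
  refine (width_le_card h.nonempty (B := s.starts ∪ t.starts) ?_).trans (Finset.card_union_le _ _)
  intro v hv hna
  rw [Finset.mem_union, Finset.mem_starts, Finset.mem_starts]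
  rcases Finset.mem_union.1 (h.subset hv) with hs | ht
  · exact .inl ⟨hs, fun u hu huv => hna u (h.arc_left u v huv hu hs (.inr hv))⟩
  · exact .inr ⟨ht, fun u hu huv => hna u (h.arc_right u v huv hu ht (.inr hv))⟩

lemma cut (h : IsFragment W s t U) {a b : V} (hs : ¬ (a ∈ s ∧ b ∈ s)) (ht : ¬ (a ∈ t ∧ b ∈ t)) :
    IsFragment W s t (U.cut a b) where
  nonempty := h.nonempty
  subset := h.subset
  constr_iff := h.constr_iff
  constr_closed := h.constr_closed
  arc_covBy u v huv := h.arc_covBy u v huv.1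
  arc_left u v huv hu hv hm :=
    ⟨h.arc_left u v huv hu hv hm, by rintro ⟨rfl, rfl⟩; exact hs ⟨hu, hv⟩⟩
  arc_right u v huv hu hv hm :=
    ⟨h.arc_right u v huv hu hv hm, by rintro ⟨rfl, rfl⟩; exact ht ⟨hu, hv⟩⟩

lemma restrict (h : IsFragment W s t U) {c d : Finset V} (hcd : U.Separates c d) :
    IsFragment W s t (U.restrict c) := by
  obtain ⟨hc, -, -, hun, hno⟩ := hcd
  have hv : (U.restrict c).verts = c := by
    change U.verts ∩ c = c
    rw [← hun]
    exact Finset.inter_eq_right.2 Finset.subset_union_left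
  have hcU : c ⊆ U.verts := hun ▸ Finset.subset_union_left
  have hside : ∀ u v, U.edge u v → u ∈ U.verts → v ∈ U.verts → u ∈ c ∨ v ∈ c → u ∈ c ∧ v ∈ c := by
    intro u v huv hu hv hm
    rw [← hun, Finset.mem_union] at hu hv
    have h1 : ¬ (u ∈ c ∧ v ∈ d) := fun hh => (hno u hh.1 v hh.2).1 huv
    have h2 : ¬ (v ∈ c ∧ u ∈ d) := fun hh => (hno v hh.1 u hh.2).2 huv
    tauto
  have harc : ∀ u v, U.arc u v → u ∈ c ∨ v ∈ c → (U.restrict c).arc u v := by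
    intro u v huv hm
    obtain ⟨h1, h2, -⟩ := U.arc_succ u v huv
    exact ⟨huv, hside u v (.inl huv) h1 h2 hm⟩
  refine ⟨hv.symm ▸ hc, hv.symm ▸ hcU.trans h.subset, fun I u v => ?_,
    fun I u v huv hu hv' hm => ?_,
    fun u v huv => h.arc_covBy u v huv.1, fun u v huv hu hv' hm => ?_,
    fun u v huv hu hv' hm => ?_⟩
  · rw [hv]
    change U.constr I u v ∧ u ∈ c ∧ v ∈ c ↔ _
    rw [h.constr_iff]
    exact ⟨fun hh => ⟨hh.1.1, hh.2⟩, fun hh => ⟨⟨hh.1, hcU hh.2.1, hcU hh.2.2⟩, hh.2⟩⟩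
  · rw [hv] at hm ⊢
    obtain ⟨h1, h2⟩ := h.constr_closed I u v huv hu hv' (hm.imp (hcU ·) (hcU ·))
    exact hside u v (.inr ⟨I, (h.constr_iff I u v).2 ⟨huv, h1, h2⟩⟩) h1 h2 hm
  · rw [hv] at hm
    exact harc u v (h.arc_left u v huv hu hv' (hm.imp (hcU ·) (hcU ·))) hm
  · rw [hv] at hm
    exact harc u v (h.arc_right u v huv hu hv' (hm.imp (hcU ·) (hcU ·))) hm

end IsFragment

lemma Separates.symm {U : SplitTCW A ℐ V} {s t : Finset V} (h : U.Separates s t) :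
    U.Separates t s :=
  ⟨h.2.1, h.1, h.2.2.1.symm, Finset.union_comm s t ▸ h.2.2.2.1,
    fun u hu v hv => (h.2.2.2.2 v hv u hu).symm⟩

/-- There is a split-tree of width at most `K`. -/
def HasTree (K : ℕ) (U : SplitTCW A ℐ V) : Prop := ∃ T : SplitTree U, T.width ≤ K

/-- A measure that decreases from a label of a split-tree to its children. -/
noncomputable def size (U : SplitTCW A ℐ V) : ℕ :=
  U.verts.card + Set.ncard {p : V × V | U.arc p.1 p.2}

lemma Separates.size_restrict_lt [Fintype V] {U : SplitTCW A ℐ V} {s t : Finset V}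
    (h : U.Separates s t) :
    (U.restrict s).size < U.size := by
  refine Nat.add_lt_add_of_lt_of_le (Finset.card_lt_card ?_)
    (Set.ncard_le_ncard (fun p hp => hp.1) (Set.toFinite _))
  obtain ⟨-, ⟨v, hv⟩, hd, hun, -⟩ := h
  refine Finset.ssubset_iff_of_subset Finset.inter_subset_left |>.2
    ⟨v, hun ▸ Finset.mem_union_right _ hv, fun hm => ?_⟩
  exact Finset.disjoint_left.1 hd (Finset.mem_inter.1 hm).2 hv

lemma size_cut_lt [Fintype V] {U : SplitTCW A ℐ V} {a b : V} (h : U.arc a b) :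
    (U.cut a b).size < U.size := by
  refine Nat.add_lt_add_left (Set.ncard_lt_ncard ⟨fun p hp => hp.1, fun hsub => ?_⟩
    (Set.toFinite _)) _
  exact (hsub (show (a, b) ∈ {p : V × V | U.arc p.1 p.2} from h)).2 ⟨rfl, rfl⟩

/-- The split-game forces moves that a splitting of sets ignores: cutting is allowed only in
connected words, and separating only in disconnected ones. Cutting just the successor edges between
`s` and `t`, and separating whenever possible, keeps every label a fragment, so its width stays
bounded by the blocks of `s` and `t`. The play ends in fragments contained in `s` or in `t`. -/
lemma IsFragment.hasTree [Fintype V] {W : TCW A ℐ V} {s t : Finset V} {K : ℕ}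
    (hst : Disjoint s t)
    (hR : ∀ u ∈ s, ∀ v ∈ t, ¬ (∃ I, W.constr I u v) ∧ ¬ ∃ I, W.constr I v u)
    (hK : s.starts.card + t.starts.card ≤ K)
    (hs : ∀ U, IsFragment W s ∅ U → HasTree K U) (ht : ∀ U, IsFragment W t ∅ U → HasTree K U)
    (U : SplitTCW A ℐ V) (hU : IsFragment W s t U) : HasTree K U := by
  induction hn : U.size using Nat.strong_induction_on generalizing U with
  | h n ih =>
  subst hn
  have hw := hU.width_le.trans hK
  by_cases hc : U.Connected
  · by_cases h1 : U.verts ⊆ s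
    · exact hs U (hU.left_of_subset h1)
    by_cases h2 : U.verts ⊆ t
    · exact ht U (hU.symm.left_of_subset h2)
    obtain ⟨v, hv, hvs⟩ := Finset.not_subset.1 h1
    obtain ⟨u, hu, hut⟩ := Finset.not_subset.1 h2
    have hus : u ∈ s := (Finset.mem_union.1 (hU.subset hu)).resolve_right hut
    -- By connectedness some edge leaves `s`. It is not a constraint, by `hR`, so it is a successor
    -- edge that may be cut.
    obtain ⟨a, b, hab, hcr⟩ := hc.exists_edge_crossing hu hv hus hvs
    have hmem : a ∈ U.verts ∧ b ∈ U.verts := by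
      rcases hab with hab | ⟨I, hab⟩
      · exact ⟨(U.arc_succ _ _ hab).1, (U.arc_succ _ _ hab).2.1⟩
      · exact ⟨(U.constr_lt _ _ _ hab).1, (U.constr_lt _ _ _ hab).2.1⟩
    have ha := Finset.mem_union.1 (hU.subset hmem.1)
    have hb := Finset.mem_union.1 (hU.subset hmem.2)
    have hda : a ∈ s → a ∉ t := fun hm => Finset.disjoint_left.1 hst hm
    have hdb : b ∈ s → b ∉ t := fun hm => Finset.disjoint_left.1 hst hm
    have harc : U.arc a b := by
      rcases hab with hab | ⟨I, hab⟩
      · exact hab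
      · exfalso
        have hab' := ((hU.constr_iff _ _ _).1 hab).1
        have k1 : ¬ (a ∈ s ∧ b ∈ t) := fun hh => (hR a hh.1 b hh.2).1 ⟨I, hab'⟩
        have k2 : ¬ (b ∈ s ∧ a ∈ t) := fun hh => (hR b hh.1 a hh.2).2 ⟨I, hab'⟩
        tauto
    obtain ⟨T, hT⟩ := ih _ (size_cut_lt harc) _ (hU.cut (a := a) (b := b) (by tauto) (by tauto)) rfl
    exact ⟨.unary U hc a b harc T, max_le hw hT⟩
  · obtain ⟨c, d, hcd⟩ := exists_separates hU.nonempty hc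
    obtain ⟨T₁, h₁⟩ := ih _ hcd.size_restrict_lt _ (hU.restrict hcd) rfl
    obtain ⟨T₂, h₂⟩ := ih _ hcd.symm.size_restrict_lt _ (hU.restrict hcd.symm) rfl
    exact ⟨.binary U c d hcd T₁ T₂, max_le hw (max_le h₁ h₂)⟩

lemma hasTree_of_decomposable [Fintype V] {W : TCW A ℐ V}
    (huniq : ∀ I J u v, W.constr I u v → W.constr J u v → I = J) {K : ℕ} (hK : 2 ≤ K)
    {s : Finset V} (hs : Decomposable (fun u v => ∃ I, W.constr I u v) K s)
    (U : SplitTCW A ℐ V) (hU : IsFragment W s ∅ U) : HasTree K U := by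
  induction hs generalizing U with
  | single p =>
    have hv : U.verts = {p} := by
      have := hU.subset
      rw [Finset.union_empty] at this
      exact hU.nonempty.subset_singleton_iff.1 this
    refine ⟨.leaf U (.inl ⟨p, hv⟩), ?_⟩
    have := width_le_card hU.nonempty (B := {p}) fun v h _ => hv ▸ h
    exact this.trans (by simp; omega)
  | pair p q h =>
    obtain ⟨I, hI⟩ := h
    have hlt := W.constr_lt _ _ _ hI
    have hsub := hU.subset
    rw [Finset.union_empty] at hsub
    -- A fragment is closed under constraints, so it cannot contain only one of the two points.
    have hpq : p ∈ U.verts ∧ q ∈ U.verts := by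
      refine hU.constr_closed I p q hI (by simp) (by simp) ?_
      obtain ⟨v, hv⟩ := hU.nonempty
      have := hsub hv
      simp only [Finset.mem_insert, Finset.mem_singleton] at this
      rcases this with rfl | rfl
      · exact .inl hv
      · exact .inr hv
    have hv : U.verts = {p, q} := by
      refine hsub.antisymm fun v hv => ?_
      simp only [Finset.mem_insert, Finset.mem_singleton] at hv
      rcases hv with rfl | rfl
      exacts [hpq.1, hpq.2]
    have hw : ∀ U' : SplitTCW A ℐ V, U'.verts = {p, q} → U'.width ≤ K := by
      intro U' hU'
      refine (width_le_card (hU' ▸ ⟨p, by simp⟩) (B := {p, q}) fun v h _ => hU' ▸ h).trans ?_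
      exact Finset.card_le_two.trans hK
    have hc : ∀ J u v, U.constr J u v ↔ J = I ∧ u = p ∧ v = q := by
      intro J u v
      rw [hU.constr_iff, hv]
      simp only [Finset.mem_insert, Finset.mem_singleton]
      constructor
      · rintro ⟨huv, hu, hv⟩
        have := W.constr_lt _ _ _ huv
        rcases hu with rfl | rfl <;> rcases hv with rfl | rfl
        · exact absurd this (lt_irrefl _)
        · exact ⟨huniq _ _ _ _ huv hI, rfl, rfl⟩
        · exact absurd this hlt.asymm
        · exact absurd this (lt_irrefl _)
      · rintro ⟨rfl, rfl, rfl⟩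
        exact ⟨hI, by simp, by simp⟩
    have hsucc : IsSuccIn U.verts p q := by
      refine ⟨hpq.1, hpq.2, hlt, fun w hw hh => ?_⟩
      rw [hv] at hw
      simp only [Finset.mem_insert, Finset.mem_singleton] at hw
      rcases hw with rfl | rfl
      exacts [lt_irrefl _ hh.1, lt_irrefl _ hh.2]
    -- An atomic pair must be separated by a hole, so a pair of adjacent positions may need one more
    -- cut.
    by_cases harc : U.arc p q
    · have hconn : U.Connected := by
        have he : Relation.EqvGen U.edge p q := .rel _ _ (.inl harc)
        refine ⟨hU.nonempty, fun u hu v hv' => ?_⟩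
        rw [hv] at hu hv'
        simp only [Finset.mem_insert, Finset.mem_singleton] at hu hv'
        rcases hu with rfl | rfl <;> rcases hv' with rfl | rfl
        exacts [.refl _, he, .symm _ _ he, .refl _]
      have hat : (U.cut p q).IsAtomic :=
        .inr ⟨p, q, I, hv, ⟨hsucc, fun hh => hh.2 ⟨rfl, rfl⟩⟩, hc⟩
      exact ⟨.unary U hconn p q harc (.leaf _ hat), max_le (hw U hv) (hw (U.cut p q) hv)⟩
    · exact ⟨.leaf U (.inr ⟨p, q, I, hv, ⟨hsucc, harc⟩, hc⟩), hw _ hv⟩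
  | union s t _ _ hst hR hK' _ _ ihs iht =>
    exact IsFragment.hasTree hst hR hK' ihs iht U hU.of_union

end SplitTCW

theorem TCW.splitWidth_le_of_decomposable {A : Type*} {ℐ : IntervalFamily} {V : Type*}
    [LinearOrder V] [Fintype V] [Nonempty V] {W : TCW A ℐ V}
    (huniq : ∀ I J u v, W.constr I u v → W.constr J u v → I = J) {K : ℕ} (hK : 2 ≤ K)
    (hd : Decomposable (fun u v => ∃ I, W.constr I u v) K Finset.univ) :
    W.toSplit.splitWidth ≤ K := by
  obtain ⟨T, hT⟩ := SplitTCW.hasTree_of_decomposable huniq hK hd W.toSplit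
    { nonempty := Finset.univ_nonempty
      subset := fun v _ => Finset.mem_union_left _ (Finset.mem_univ v)
      constr_iff := fun I u v => ⟨fun h => ⟨h, Finset.mem_univ u, Finset.mem_univ v⟩, fun h => h.1⟩
      constr_closed := fun _ u v _ _ _ _ => ⟨Finset.mem_univ u, Finset.mem_univ v⟩
      arc_covBy := fun _ _ h => h
      arc_left := fun _ _ h _ _ _ => h
      arc_right := fun _ _ h _ _ _ => h }
  exact (iInf_le _ T).trans (by exact_mod_cast hT)

/-! ### The constraints of a run: clocks and stack -/

section Run

variable {Q A Γ X : Type*} {ℐ : IntervalFamily} {n : ℕ}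

lemma pushes_add_pushes (δ : Fin n → Transition Q A Γ X ℐ) {a b c : ℕ} (hab : a ≤ b)
    (hbc : b ≤ c) : pushes δ a b + pushes δ b c = pushes δ a c := by
  classical
  rw [pushes, pushes, pushes, ← Finset.card_union_of_disjoint]
  · congr 1
    ext k
    simp only [Finset.mem_union, Finset.mem_filter, Finset.mem_univ, true_and]
    grind
  · rw [Finset.disjoint_left]
    intro k h1 h2
    simp only [Finset.mem_filter] at h1 h2
    omega

lemma pops_add_pops (δ : Fin n → Transition Q A Γ X ℐ) {a b c : ℕ} (hab : a ≤ b)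
    (hbc : b ≤ c) : pops δ a b + pops δ b c = pops δ a c := by
  classical
  rw [pops, pops, pops, ← Finset.card_union_of_disjoint]
  · congr 1
    ext k
    simp only [Finset.mem_union, Finset.mem_filter, Finset.mem_univ, true_and]
    grind
  · rw [Finset.disjoint_left]
    intro k h1 h2
    simp only [Finset.mem_filter] at h1 h2
    omega

lemma pushes_pos {δ : Fin n → Transition Q A Γ X ℐ} {i : Fin n} (hi : (δ i).op.isPush = true) :
    0 < pushes δ i.val (i.val + 1) :=
  Finset.card_pos.2 ⟨i, by simp [hi]⟩

lemma pops_eq_zero {δ : Fin n → Transition Q A Γ X ℐ} {i : Fin n}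
    (hi : (δ i).op.isPush = true) : pops δ i.val (i.val + 1) = 0 := by
  refine Finset.card_eq_zero.2 (Finset.eq_empty_of_forall_notMem fun k hk => ?_)
  simp only [Finset.mem_filter, Finset.mem_univ, true_and] at hk
  obtain rfl : k = i := Fin.ext (by omega)
  have := hk.2.2
  cases hop : (δ k).op <;> simp_all [StackOp.isPush, StackOp.isPop]

/-- Suppose `j ≤ j'`. Between `i` and `i'`, and between `i'` and `j`, there are at least as many
pushes as pops. The push at `i'` is one more, so the operations between `i` and `j` are not
balanced. -/
lemma Matching.nested {δ : Fin n → Transition Q A Γ X ℐ} {i j i' j' : Fin n}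
    (h : Matching δ i j) (h' : Matching δ i' j') (hi : i < i') (hj : i' < j) : j' < j := by
  by_contra hle
  obtain ⟨-, -, -, hw, he⟩ := h
  obtain ⟨-, hp, -, hw', -⟩ := h'
  have hi : i.val + 1 ≤ i'.val := hi
  have hj : i'.val + 1 ≤ j.val := hj
  have hjj : j.val ≤ j'.val := not_lt.1 hle
  have h1 := hw i'.val (by omega)
  have h2 := hw' j.val hjj
  have h3 := pushes_add_pushes δ hi (Nat.le_add_right i'.val 1)
  have h4 := pushes_add_pushes δ (hi.trans (Nat.le_add_right i'.val 1)) hj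
  have h5 := pops_add_pops δ hi (Nat.le_add_right i'.val 1)
  have h6 := pops_add_pops δ (hi.trans (Nat.le_add_right i'.val 1)) hj
  have h7 := pushes_pos hp
  have h8 := pops_eq_zero hp
  omega

lemma RunPoint.key_lt_key_iff {h g : Fin (n + 1) → ℕ} (a b : RunPoint n h g) :
    a.key < b.key ↔ (ofLex a.key).1 < (ofLex b.key).1 ∨ (ofLex a.key).1 = (ofLex b.key).1 ∧
      ((ofLex (ofLex a.key).2).1 < (ofLex (ofLex b.key).2).1 ∨
        (ofLex (ofLex a.key).2).1 = (ofLex (ofLex b.key).2).1 ∧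
          (ofLex (ofLex a.key).2).2 < (ofLex (ofLex b.key).2).2) := by
  rw [Prod.Lex.lt_iff, Prod.Lex.lt_iff]

variable {V : Type*} [LinearOrder V]

lemma TCW.IsSimple.isOrderedMatching [Fintype V] {W : TCW A ℐ V} (h : W.IsSimple) :
    IsOrderedMatching fun u v => ∃ I, W.constr I u v where
  lt := fun ⟨I, hI⟩ => W.constr_lt _ _ _ hI
  right_unique {u v v'} h1 h2 := by
    have := h u
    have h3 : W.outdegree u ≤ 1 := by omega
    exact (Set.ncard_le_one (Set.toFinite _)).1 h3 v h1 v' h2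
  left_unique {u u' v} h1 h2 := by
    have := h v
    have h3 : W.indegree v ≤ 1 := by omega
    exact (Set.ncard_le_one (Set.toFinite _)).1 h3 u h1 u' h2
  not_both {u v w} h1 h2 := by
    have := h v
    have h3 : 0 < W.indegree v := (Set.ncard_pos (Set.toFinite _)).2 ⟨u, h1⟩
    have h4 : 0 < W.outdegree v := (Set.ncard_pos (Set.toFinite _)).2 ⟨w, h2⟩
    omega

namespace IsGeneratedBy

variable {S : TPDA Q A Γ X ℐ} {W : TCW A ℐ V} {σ : Fin (n + 1) → Q}
  {δ : Fin n → Transition Q A Γ X ℐ} {g : Fin (n + 1) → ℕ}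
  {pos : RunPoint n (fun i => (blockGuard δ i).length) g → V}
  {clk : X → ℐ.Elem → V → V → Prop}

/-- The constraints of the clocks; `none` is the extra clock that is `0` throughout a block. -/
def clockRel (δ : Fin n → Transition Q A Γ X ℐ)
    (pos : RunPoint n (fun i => (blockGuard δ i).length) g → V)
    (clk : X → ℐ.Elem → V → V → Prop) : Option X → V → V → Prop
  | none, u, v => ∃ i, u = pos (.left i) ∧ v = pos (.right i)
  | some x, u, v => ∃ I, clk x I u v

/-- The constraints of the stack. -/
def stackRel (δ : Fin n → Transition Q A Γ X ℐ)
    (pos : RunPoint n (fun i => (blockGuard δ i).length) g → V) (u v : V) : Prop :=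
  ∃ i j b I, Matching δ i j ∧ (δ i).op = .push b ∧ (δ j).op = .pop b I ∧
      u = pos (.action i) ∧ v = pos (.action j)

lemma rel_iff (h : IsGeneratedBy S W σ δ g pos clk) (u v : V) :
    (∃ I, W.constr I u v) ↔ (∃ c, clockRel δ pos clk c u v) ∨ stackRel δ pos u v := by
  simp only [h.constr_iff, Option.exists, clockRel, stackRel]
  constructor
  · rintro ⟨I, ⟨-, hz⟩ | ⟨i, j, b, hm⟩ | ⟨x, hx⟩⟩
    · exact .inl (.inl hz)
    · exact .inr ⟨i, j, b, I, hm⟩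
    · exact .inl (.inr ⟨x, I, hx⟩)
  · rintro ((hz | ⟨x, I, hx⟩) | ⟨i, j, b, I, hm⟩)
    · exact ⟨ℐ.zero, .inl ⟨rfl, hz⟩⟩
    · exact ⟨I, .inr (.inr ⟨x, hx⟩)⟩
    · exact ⟨I, .inr (.inl ⟨i, j, b, hm⟩)⟩

/-- Simplicity counts neighbours, not intervals, so it does not exclude two intervals on one pair;
an atomic pair carries exactly one. Here the kinds of the two points tell which sort of constraint
it is, and the pop or the guard conjunct at the target fixes its interval. -/
lemma constr_unique (h : IsGeneratedBy S W σ δ g pos clk) (I J : ℐ.Elem) (u v : V)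
    (hI : W.constr I u v) (hJ : W.constr J u v) : I = J := by
  have hinj := h.pos_bijective.1
  rw [h.constr_iff] at hI hJ
  rcases hI with ⟨rfl, i, rfl, rfl⟩ | ⟨i, j, b, -, -, hp, rfl, rfl⟩ | ⟨x, hx⟩
  · rcases hJ with ⟨rfl, -⟩ | ⟨_, _, _, -, -, -, hu, -⟩ | ⟨x, hx⟩
    · rfl
    · cases hinj hu
    · obtain ⟨_, _, _, _, -, hu, -⟩ := h.clk_sound _ _ _ _ hx
      cases hinj hu
  · rcases hJ with ⟨-, _, hu, -⟩ | ⟨i', j', b', -, -, hp', -, hv⟩ | ⟨x, hx⟩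
    · cases hinj hu
    · obtain rfl : j = j' := by simpa using hinj hv
      rw [hp] at hp'
      simp_all
    · obtain ⟨_, _, _, _, -, hu, -⟩ := h.clk_sound _ _ _ _ hx
      cases hinj hu
  · obtain ⟨i, j, s, t, hl, rfl, rfl⟩ := h.clk_sound _ _ _ _ hx
    rcases hJ with ⟨-, _, hu, -⟩ | ⟨_, _, _, -, -, -, hu, -⟩ | ⟨x', hx'⟩
    · cases hinj hu
    · cases hinj hu
    · obtain ⟨i', j', s', t', hl', -, hv⟩ := h.clk_sound _ _ _ _ hx'
      have := hinj hv
      rw [RunPoint.guard.injEq] at this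
      obtain ⟨rfl, ht⟩ := this
      obtain rfl := eq_of_heq ht
      have := hl.2.1.symm.trans hl'.2.1
      simp_all

lemma isGroupedNested_clockRel (h : IsGeneratedBy S W σ δ g pos clk) (c : Option X) :
    IsGroupedNested (clockRel δ pos clk c) := by
  intro u v u' v' huv huv' hlt hlt' w hw hw'
  cases c with
  -- The constraints of the extra clock span disjoint blocks, so they never overlap.
  | none =>
    exfalso
    obtain ⟨i, rfl, rfl⟩ := huv
    obtain ⟨i', rfl, rfl⟩ := huv'
    rw [h.pos_lt, RunPoint.key_lt_key_iff] at hlt hlt'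
    simp [RunPoint.key] at hlt hlt'
    omega
  | some x =>
    obtain ⟨I, huv⟩ := huv
    obtain ⟨I', huv'⟩ := huv'
    obtain ⟨i, j, s, t, hl, rfl, rfl⟩ := h.clk_sound _ _ _ _ huv
    obtain ⟨i', j', s', t', hl', rfl, rfl⟩ := h.clk_sound _ _ _ _ huv'
    rw [h.pos_lt, RunPoint.key_lt_key_iff] at hlt hlt'
    simp [RunPoint.key] at hlt hlt'
    -- A later block `i'` before `j` that resets `x` would contradict that `i` is the last reset of
    -- `x` before `j`. So both constraints start in the same block.
    have hni : ¬ i < i' := fun hii => by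
      refine hl.2.2.2 i' hii ?_ hl'.2.2.1
      omega
    obtain rfl : i = i' := Fin.ext (by omega)
    obtain ⟨a, rfl⟩ := h.pos_bijective.2 w
    rw [h.pos_lt, RunPoint.key_lt_key_iff] at hw hw'
    -- Only reset points occur between two reset points of one block.
    cases a with
    | left k => simp [RunPoint.key] at hw hw'; omega
    | guard k r => simp [RunPoint.key] at hw hw'; omega
    | action k => simp [RunPoint.key] at hw hw'; omega
    | right k => simp [RunPoint.key] at hw hw'; omega
    | reset k r =>
      simp [RunPoint.key] at hw hw'
      obtain rfl : i = k := Fin.ext (by omega)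
      have h1 : s < r := by simpa using hw
      have h2 : r < s' := by simpa using hw'
      obtain ⟨I'', z, hz⟩ := h.grouped i s r s' x h1 h2 ⟨I, _, huv⟩ ⟨I', _, huv'⟩
      exact ⟨z, ⟨I'', hz⟩, (h.clk_nested x _ _ i r s' _ _ hz huv' h2).2,
        (h.clk_nested x _ _ i s r _ _ huv hz h1).2⟩

lemma stackRel_nested (h : IsGeneratedBy S W σ δ g pos clk) {u v u' v' : V}
    (huv : stackRel δ pos u v) (huv' : stackRel δ pos u' v') (hlt : u < u') (hlt' : u' < v) :
    v' < v := by
  have hact : ∀ k k', pos (.action k) < pos (.action k') ↔ k < k' := fun k k' => by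
    rw [h.pos_lt, RunPoint.key_lt_key_iff]
    simp [RunPoint.key]
  obtain ⟨i, j, b, I, hm, -, -, rfl, rfl⟩ := huv
  obtain ⟨i', j', b', I', hm', -, -, rfl, rfl⟩ := huv'
  rw [hact] at hlt hlt' ⊢
  exact hm.nested hm' hlt hlt'

lemma isClockStackMatching [Fintype V] (h : IsGeneratedBy S W σ δ g pos clk)
    (hW : W.IsSimple) :
    IsClockStackMatching (fun u v => ∃ I, W.constr I u v) (clockRel δ pos clk)
      (stackRel δ pos) where
  toIsOrderedMatching := hW.isOrderedMatching
  rel_iff := h.rel_iff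
  grouped := h.isGroupedNested_clockRel
  nested := h.stackRel_nested

lemma not_stackRel (h : IsGeneratedBy S W σ δ g pos clk) (hS : S.IsTimedAutomaton) (u v : V) :
    ¬ stackRel δ pos u v := by
  rintro ⟨i, j, b, I, -, hp, -⟩
  rw [hS _ (h.trans_mem i)] at hp
  cases hp

end IsGeneratedBy

end Run

/-! ### The two bounds -/

theorem mainTheorem3 {Q A Γ X : Type*} [Finite Q] [Finite A] [Finite Γ] [Fintype X]
    (ℐ : IntervalFamily) (S : TPDA Q A Γ X ℐ) (V : Type*) [LinearOrder V] [Fintype V] :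
    (S.IsTimedAutomaton → S.stcw V ⊆ boundedSTCW A ℐ V (Fintype.card X + 4)) ∧
      S.stcw V ⊆ boundedSTCW A ℐ V (4 * Fintype.card X + 6) := by
  refine ⟨?_, ?_⟩
  · rintro hS W ⟨hW, n, σ, δ, g, pos, clk, h⟩
    have : Nonempty V := ⟨pos (.left 0)⟩
    have hd := (h.isClockStackMatching hW).decomposable_of_isLowerSet (h.not_stackRel hS)
      Finset.univ (by simpa using isLowerSet_univ)
      (by rw [targetPreimage_univ]; exact Finset.univ_nonempty)
    -- The extra clock makes `c = |X| + 1`, so `c + 3 = |X| + 4`.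
    rw [targetPreimage_univ, Fintype.card_option] at hd
    exact ⟨hW, TCW.splitWidth_le_of_decomposable h.constr_unique (by omega) hd⟩
  · rintro W ⟨hW, n, σ, δ, g, pos, clk, h⟩
    have : Nonempty V := ⟨pos (.left 0)⟩
    have hd := (h.isClockStackMatching hW).decomposable_of_ordConnected
      Finset.univ (by simpa using Set.ordConnected_univ) (by simp)
      (by rw [targetPreimage_univ]; exact Finset.univ_nonempty)
    -- Likewise `4c + 2 = 4|X| + 6`.
    rw [targetPreimage_univ, Fintype.card_option] at hd
    exact ⟨hW, TCW.splitWidth_le_of_decomposable h.constr_unique (by omega) hd⟩
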